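/- A quantum coin flipping protocol with $n$ rounds is an interaction between Alice and Bob, each holding a private finite-dimensional quantum memory. A round consists of one (finite-dimensional) quantum message from Alice to Bob followed by one from Bob to Alice. Before sending and after receiving a message a player may apply any quantum instrument (given by finitely many Kraus operators $K_k$ with $\sum_k K_k^\dagger K_k = 1$) whose classical result may influence all later actions of that player. At the end Alice outputs $c_A$ and Bob outputs $c_B$ in $\{0,1,\mathrm{Abort}\}$; the outcome of the protocol is $c=c_A$ if $c_A=c_B$ and $c=\mathrm{Abort}$ otherwise. "Alice wins" means $c=0$ and "Bob wins" means $c=1$. A cheating player may use an arbitrary strategy of this kind in place of the prescribed one. For real $z,\varepsilon$, a protocol is a $\mathrm{WCF}(z,\varepsilon)$ protocol if (i) when both players are honest, $\Pr[\text{Alice wins}]=z$ and $\Pr[\text{Bob wins}]=1-z$; (ii) when Bob is honest, $\Pr[\text{Alice wins}]\le z+\varepsilon$ for every strategy of Alice; (iii) when Alice is honest, $\Pr[\text{Bob wins}]\le (1-z)+\varepsilon$ for every strategy of Bob. Given protocols $P$, $P_1$, $P_2$ with $N$, $M_1$, $M_2$ rounds, let $\mathrm{Comb}(P_1,P_2)$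 be the following protocol with $N+\max(M_1,M_2)$ rounds: the players run $P$; if Alice wins $P$ they run $P_2$; if Bob wins $P$ they run $P_1$; if $P$ aborts they abort. Here each honest player goes by the value that he or she obtained in $P$, and the second phase has a common message format into which the messages of $P_1$ and $P_2$ are embedded, the shorter of the two being padded with dummy messages; an honest player who receives a message outside the expected message space aborts. **Lemma.** Let $P$ be a $\mathrm{WCF}(1/2,\varepsilon)$ protocol, $P_1$ a $\mathrm{WCF}(z_1,\varepsilon_0)$ protocol and $P_2$ a $\mathrm{WCF}(z_2,\varepsilon_0)$ protocol, with $z_2\ge z_1$. Then $\mathrm{Comb}(P_1,P_2)$ is a $$\mathrm{WCF}\Bigl(\frac{z_1+z_2}{2},\ \varepsilon_0+\varepsilon\,(z_2-z_1)\Bigr)$$ protocol. -/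

import Mathlib

namespace CoinFlipping

open scoped Matrix

/-- The two players. -/
inductive Role where
  | alice
  | bob
deriving DecidableEq

/-- The values a player can output: `zero` ("Alice wins"), `one` ("Bob wins"), or `abort`. -/
inductive Outcome where
  | zero
  | one
  | abort
deriving DecidableEq

/-- The outcome of the protocol: the common value of the two players, and `abort` if they differ. -/
def Outcome.joint (a b : Outcome) : Outcome := if a = b then a else .abort

/-- A slot of the communication schedule: who sends, and the dimension of the quantum message. -/
structure Message where
  sender : Role
  dim : ℕ+

/-- A schedule consists of `n` rounds if it is `n` times a message from Alice to Bob followed by a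
message from Bob to Alice. -/
def HasRounds : ℕ → List Message → Prop
  | 0, s => s = []
  | n + 1, s => ∃ (x y : ℕ+) (s' : List Message),
      s = ⟨.alice, x⟩ :: ⟨.bob, y⟩ :: s' ∧ HasRounds n s'

/-- `Party me s d` is a complete local program (strategy) for player `me`, who holds a private
quantum memory `ℂ^d`, when the messages that are still to be exchanged are those listed in `s`.

All local operations are quantum instruments given by Kraus operators `K k`, with
`∑ k, (K k)ᴴ * K k = 1`; the player learns the (private) classical result `k` and all later actions
may depend on it. A general quantum channel is the case in which `k` is ignored later on.
* `output o`: no message is left; announce `o`. The memory is then trivial (`ℂ^1`): it has been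
  measured or discarded in the last operation.
* `send`: apply an instrument to the memory that produces a new memory and the message, send the
  message, and continue.
* `recv`: receive the message, apply an instrument to memory and message together, and continue. -/
inductive Party (me : Role) : List Message → ℕ → Type 1
  | output (o : Outcome) : Party me [] 1
  | send {m : Message} {s : List Message} {d : ℕ} (hm : m.sender = me)
      (ι : Type) [Fintype ι] (mem : ι → ℕ)
      (K : (k : ι) → Matrix (Fin (mem k) × Fin m.dim) (Fin d) ℂ)
      (hK : ∑ k, (K k)ᴴ * K k = 1)
      (next : (k : ι) → Party me s (mem k)) : Party me (m :: s) d
  | recv {m : Message} {s : List Message} {d : ℕ} (hm : m.sender ≠ me)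
      (ι : Type) [Fintype ι] (mem : ι → ℕ)
      (K : (k : ι) → Matrix (Fin (mem k)) (Fin d × Fin m.dim) ℂ)
      (hK : ∑ k, (K k)ᴴ * K k = 1)
      (next : (k : ι) → Party me s (mem k)) : Party me (m :: s) d

/-! ### Execution -/

/-- Alice applies `K` to her memory and sends the message part of the result to Bob, who applies `L`
to his memory and that message: the joint vector `ψ ∈ ℂ^d ⊗ ℂ^e` becomes
`(1 ⊗ L) (K ⊗ 1) ψ ∈ ℂ^d' ⊗ ℂ^e'`. -/
noncomputable def transmitAB {d e d' e' x : ℕ} (K : Matrix (Fin d' × Fin x) (Fin d) ℂ)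
    (L : Matrix (Fin e') (Fin e × Fin x) ℂ) (ψ : Fin d → Fin e → ℂ) : Fin d' → Fin e' → ℂ :=
  fun i' j' => ∑ i, ∑ j, ∑ m, K (i', m) i * L j' (j, m) * ψ i j

/-- The same with the message going from Bob (who applies `K`) to Alice (who applies `L`). -/
noncomputable def transmitBA {d e d' e' x : ℕ} (K : Matrix (Fin e' × Fin x) (Fin e) ℂ)
    (L : Matrix (Fin d') (Fin d × Fin x) ℂ) (ψ : Fin d → Fin e → ℂ) : Fin d' → Fin e' → ℂ :=
  fun i' j' => ∑ i, ∑ j, ∑ m, K (j', m) j * L i' (i, m) * ψ i j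

/-- The probability that the protocol outputs `c` when Alice runs `a` and Bob runs `b` from the joint
state `ψ`. As all classical results are recorded, the state along each branch stays a vector; its
squared norm is the probability of the branch. -/
noncomputable def run (c : Outcome) : {s : List Message} → {d e : ℕ} →
    Party .alice s d → Party .bob s e → (Fin d → Fin e → ℂ) → ℝ
  | _, _, _, .output a, .output b, ψ => if a.joint b = c then ‖ψ 0 0‖ ^ 2 else 0
  | _, _, _, @Party.send _ _ _ _ _ ι _ _ K _ next, @Party.recv _ _ _ _ _ κ _ _ L _ next', ψ =>
      ∑ k : ι, ∑ l : κ, run c (next k) (next' l) (transmitAB (K k) (L l) ψ)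
  | _, _, _, @Party.recv _ _ _ _ _ ι _ _ L _ next, @Party.send _ _ _ _ _ κ _ _ K _ next', ψ =>
      ∑ k : ι, ∑ l : κ, run c (next k) (next' l) (transmitBA (K l) (L k) ψ)
  | _, _, _, @Party.send _ _ _ _ ha _ _ _ _ _ _, @Party.send _ _ _ _ hb _ _ _ _ _ _, _ =>
      nomatch ha.symm.trans hb
  | _, _, _, @Party.recv _ m _ _ ha _ _ _ _ _ _, @Party.recv _ _ _ _ hb _ _ _ _ _ _, _ =>
      absurd (show m.sender = .alice ∨ m.sender = .bob by cases m.sender <;> simp)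
        (not_or.mpr ⟨ha, hb⟩)

/-- The probability that the interaction of `a` and `b` outputs `c`. Initially the players hold
nothing (trivial memories `ℂ^1`). -/
noncomputable def prob {s : List Message} (a : Party .alice s 1) (b : Party .bob s 1)
    (c : Outcome) : ℝ :=
  run c a b fun _ _ => 1

/-- A quantum coin flipping protocol with `n` rounds: a public communication schedule, and the
programs of the honest players. -/
structure Protocol (n : ℕ) where
  schedule : List Message
  hasRounds : HasRounds n schedule
  alice : Party .alice schedule 1
  bob : Party .bob schedule 1

/-- `P` is a `WCF(z, ε)` protocol. A cheating player may run any program whatsoever. -/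
structure Protocol.IsWCF {n : ℕ} (P : Protocol n) (z ε : ℝ) : Prop where
  honest_alice_wins : prob P.alice P.bob .zero = z
  honest_bob_wins : prob P.alice P.bob .one = 1 - z
  cheating_alice : ∀ a : Party .alice P.schedule 1, prob a P.bob .zero ≤ z + ε
  cheating_bob : ∀ b : Party .bob P.schedule 1, prob P.alice b .one ≤ (1 - z) + ε

/-! ### Sequential composition -/

/-- Run a program to its end and continue with the program `f o`, where `o` is the own output. -/
def Party.andThen {me : Role} {t : List Message} : {s : List Message} → {d : ℕ} →
    Party me s d → (Outcome → Party me t 1) → Party me (s ++ t) d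
  | _, _, .output o, f => f o
  | _, _, @Party.send _ _ _ _ hm ι _ mem K hK next, f => .send hm ι mem K hK fun k => (next k).andThen f
  | _, _, @Party.recv _ _ _ _ hm ι _ mem K hK next, f => .recv hm ι mem K hK fun k => (next k).andThen f

/-- Stay idle (send a fixed basis state, discard what is received) and finally output `o`. -/
noncomputable def Party.idle {me : Role} (o : Outcome) : (s : List Message) → Party me s 1
  | [] => .output o
  | m :: s =>
      if hm : m.sender = me then
        .send hm Unit (fun _ => 1) (fun _ => Matrix.of fun p _ => if p.2.val = 0 then 1 else 0)
          (by
            ext i j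
            fin_cases i; fin_cases j
            have h : ∀ q : Fin m.dim, (q : ℕ) = 0 ↔ q = ⟨0, m.dim.pos⟩ := fun q =>
              ⟨fun h => Fin.ext h, fun h => by rw [h]⟩
            simp [Matrix.mul_apply, Fintype.sum_prod_type, h])
          fun _ => Party.idle o s
      else
        .recv hm (Fin m.dim) (fun _ => 1) (fun y => Matrix.of fun _ q => if q.2 = y then 1 else 0)
          (by
            ext ⟨i, i'⟩ ⟨j, j'⟩
            fin_cases i; fin_cases j
            simp [Matrix.sum_apply, Matrix.mul_apply, Matrix.one_apply])
          fun _ => Party.idle o s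

/-- The schedule `s` fits into `t`: `t` is at least as long, and has at each place of `s` the same
sender and a message space of at least the same dimension. -/
def Fits : List Message → List Message → Prop
  | [], _ => True
  | _ :: _, [] => False
  | m :: s, m' :: t => m.sender = m'.sender ∧ m.dim ≤ m'.dim ∧ Fits s t

/-- A Kraus operator that emits a message in `ℂ^x`, viewed as emitting a message in `ℂ^y ⊇ ℂ^x`. -/
def embedSend {d d' x y : ℕ} (K : Matrix (Fin d' × Fin x) (Fin d) ℂ) :
    Matrix (Fin d' × Fin y) (Fin d) ℂ :=
  fun p j => if h : p.2.val < x then K (p.1, ⟨p.2, h⟩) j else 0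

/-- A Kraus operator that takes a message in `ℂ^x`, preceded by the projection of `ℂ^y` to `ℂ^x`. -/
def embedRecv {d d' x y : ℕ} (L : Matrix (Fin d') (Fin d × Fin x) ℂ) :
    Matrix (Fin d') (Fin d × Fin y) ℂ :=
  fun i q => if h : q.2.val < x then L i (q.1, ⟨q.2, h⟩) else 0

/-- The Kraus operators that detect a message outside `ℂ^x` and discard memory and message. -/
def rejectRecv {d x y : ℕ} (p : Fin d × Fin y) : Matrix (Fin 1) (Fin d × Fin y) ℂ :=
  fun _ q => if q = p ∧ x ≤ p.2.val then 1 else 0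

theorem sum_dite_lt {x y : ℕ} (h : x ≤ y) (f : Fin x → ℂ) :
    (∑ q : Fin y, if hq : q.val < x then f ⟨q, hq⟩ else 0) = ∑ q, f q := by
  obtain ⟨k, rfl⟩ := Nat.exists_eq_add_of_le h
  rw [Fin.sum_univ_add]
  simp

theorem embedSend_gram {d d' x y : ℕ} (h : x ≤ y) (K : Matrix (Fin d' × Fin x) (Fin d) ℂ) :
    (embedSend (y := y) K)ᴴ * embedSend (y := y) K = Kᴴ * K := by
  ext i j
  simp only [Matrix.mul_apply, Fintype.sum_prod_type, Matrix.conjTranspose_apply]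
  refine Finset.sum_congr rfl fun a _ => ?_
  rw [← sum_dite_lt h]
  refine Finset.sum_congr rfl fun q _ => ?_
  by_cases hq : q.val < x <;> simp [embedSend, hq]

theorem embedRecv_complete {ι : Type} [Fintype ι] {mem : ι → ℕ} {d x y : ℕ}
    (L : (k : ι) → Matrix (Fin (mem k)) (Fin d × Fin x) ℂ) (hL : ∑ k, (L k)ᴴ * L k = 1) :
    (∑ k, (embedRecv (y := y) (L k))ᴴ * embedRecv (L k)) +
      ∑ p : Fin d × Fin y, (rejectRecv (x := x) p)ᴴ * rejectRecv (x := x) p = 1 := by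
  ext ⟨i, q⟩ ⟨j, r⟩
  have hrej : (∑ p : Fin d × Fin y, (rejectRecv (x := x) p)ᴴ * rejectRecv (x := x) p) (i, q) (j, r)
      = if x ≤ q.val then (1 : Matrix (Fin d × Fin y) (Fin d × Fin y) ℂ) (i, q) (j, r) else 0 := by
    rw [Matrix.sum_apply, Finset.sum_eq_single (i, q)]
    · by_cases hx : x ≤ q.val <;>
        simp [Matrix.mul_apply, rejectRecv, hx, Matrix.one_apply, eq_comm]
    · rintro p - hp
      simp [Matrix.mul_apply, rejectRecv, Ne.symm hp]
    · simp
  rw [Matrix.add_apply, hrej, Matrix.sum_apply]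
  by_cases hq : q.val < x
  · by_cases hr : r.val < x
    · have := congrFun (congrFun hL (i, ⟨q, hq⟩)) (j, ⟨r, hr⟩)
      rw [Matrix.sum_apply] at this
      simpa [embedRecv, Matrix.mul_apply, hq, hr, Matrix.one_apply, Fin.ext_iff, not_le.mpr hq]
        using this
    · have hne : q ≠ r := fun h => hr (h ▸ hq)
      simp [embedRecv, Matrix.mul_apply, hr, hne]
  · have hq' : x ≤ q.val := not_lt.mp hq
    simp [embedRecv, Matrix.mul_apply, hq, hq']

/-- The same program in a schedule `t` into which the original schedule fits: messages are embedded
in the larger message spaces, a received message that is not in the expected space leads to `abort`,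
and the player is idle in the additional slots at the end. -/
noncomputable def Party.extend {me : Role} : {s : List Message} → {d : ℕ} → Party me s d →
    (t : List Message) → Fits s t → Party me t d
  | _, _, .output o, t, _ => Party.idle o t
  | _, _, @Party.send _ _ _ _ hm ι _ mem K hK next, _ :: t, h =>
      .send (h.1 ▸ hm) ι mem (fun k => embedSend (K k))
        ((Finset.sum_congr rfl fun k _ => embedSend_gram h.2.1 (K k)).trans hK)
        fun k => (next k).extend t h.2.2
  | _, d, @Party.recv _ m _ _ hm ι _ mem K hK next, m' :: t, h =>
      .recv (h.1 ▸ hm) (ι ⊕ (Fin d × Fin m'.dim)) (Sum.elim mem fun _ => 1)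
        (fun k => match k with
          | .inl k => embedRecv (K k)
          | .inr p => rejectRecv (x := m.dim) p)
        (by rw [Fintype.sum_sum_type]; exact embedRecv_complete K hK)
        (fun k => match k with
          | .inl k => (next k).extend t h.2.2
          | .inr _ => Party.idle .abort t)

/-- The smallest schedule into which two schedules (with the same pattern of senders) fit. -/
def merge : List Message → List Message → List Message
  | [], t => t
  | m :: s, [] => m :: s
  | m :: s, m' :: t => ⟨m.sender, max m.dim m'.dim⟩ :: merge s t

theorem fits_refl : ∀ s : List Message, Fits s s
  | [] => trivial
  | _ :: s => ⟨rfl, le_rfl, fits_refl s⟩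

theorem fits_merge_left : ∀ s t : List Message, Fits s (merge s t)
  | [], _ => trivial
  | _ :: s, [] => ⟨rfl, le_rfl, fits_refl s⟩
  | _ :: s, _ :: t => ⟨rfl, le_max_left _ _, fits_merge_left s t⟩

theorem fits_merge_right : ∀ {k l : ℕ} {s t : List Message}, HasRounds k s → HasRounds l t →
    Fits t (merge s t)
  | 0, _, _, t, hs, _ => by
      obtain rfl := hs
      exact fits_refl t
  | _ + 1, 0, _, _, _, ht => by
      obtain rfl := ht
      trivial
  | _ + 1, _ + 1, _, _, hs, ht => by
      obtain ⟨x, y, s, rfl, hs⟩ := hs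
      obtain ⟨x', y', t, rfl, ht⟩ := ht
      exact ⟨rfl, le_max_right _ _, rfl, le_max_right _ _, fits_merge_right hs ht⟩

theorem hasRounds_merge : ∀ {k l : ℕ} {s t : List Message}, HasRounds k s → HasRounds l t →
    HasRounds (max k l) (merge s t)
  | 0, l, _, _, hs, ht => by
      obtain rfl := hs
      simpa [merge] using ht
  | k + 1, 0, _, _, hs, ht => by
      obtain rfl := ht
      obtain ⟨x, y, s, rfl, hs⟩ := hs
      exact ⟨x, y, s, rfl, hs⟩
  | k + 1, l + 1, _, _, hs, ht => by
      obtain ⟨x, y, s, rfl, hs⟩ := hs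
      obtain ⟨x', y', t, rfl, ht⟩ := ht
      rw [Nat.add_max_add_right]
      exact ⟨_, _, _, rfl, hasRounds_merge hs ht⟩

theorem hasRounds_append : ∀ {k l : ℕ} {s t : List Message}, HasRounds k s → HasRounds l t →
    HasRounds (k + l) (s ++ t)
  | 0, l, _, _, hs, ht => by
      obtain rfl := hs
      simpa using ht
  | k + 1, l, _, _, hs, ht => by
      obtain ⟨x, y, s, rfl, hs⟩ := hs
      rw [Nat.add_right_comm]
      exact ⟨x, y, _, rfl, hasRounds_append hs ht⟩

/-- `Comb(P₁, P₂)`: run `P`; if Alice wins `P`, run `P₂`; if Bob wins `P`, run `P₁`; if `P` aborts,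
abort. Each honest player goes by the value that he or she obtained in `P`. -/
noncomputable def comb {n m₁ m₂ : ℕ} (P : Protocol n) (P₁ : Protocol m₁) (P₂ : Protocol m₂) :
    Protocol (n + max m₁ m₂) where
  schedule := P.schedule ++ merge P₁.schedule P₂.schedule
  hasRounds := hasRounds_append P.hasRounds (hasRounds_merge P₁.hasRounds P₂.hasRounds)
  alice := P.alice.andThen fun o => match o with
    | .zero => P₂.alice.extend _ (fits_merge_right P₁.hasRounds P₂.hasRounds)
    | .one => P₁.alice.extend _ (fits_merge_left _ _)
    | .abort => Party.idle .abort _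
  bob := P.bob.andThen fun o => match o with
    | .zero => P₂.bob.extend _ (fits_merge_right P₁.hasRounds P₂.hasRounds)
    | .one => P₁.bob.extend _ (fits_merge_left _ _)
    | .abort => Party.idle .abort _

end CoinFlipping

namespace CoinFlipping

open scoped Matrix Kronecker

/-! ### A role-independent form of the execution -/

/-! When both players are honest, `P` never aborts, so they always enter the same branch, and `P₂`
and `P₁` are each run with probability 1/2.

Suppose Alice cheats. When Bob leaves `P` with output `o`, his memory is trivial, so all that
remains is an unnormalised vector on Alice's memory. From it she wins with probability at most `z₂ +
ε₀`, `z₁ + ε₀` or 0, relative to its weight, according as `o` is `zero`, `one` or `abort`. Hence her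
total is at most `(z₁ + ε₀) + (z₂ - z₁) * q`, with `q` the probability that Bob outputs `zero` in
`P`. Cutting her strategy off after `P` and announcing `zero` wins `P` with probability `q`, so `q ≤
1/2 + ε`. Only the gap `z₂ - z₁` is multiplied by `ε`. Cheating Bob is the mirror image, which is
why `play` treats both roles alike.

Two reductions are needed because the composite cheater lives on a longer schedule with larger
messages. `exists_mixed_andThen` cuts the cheater off after the first phase; `exists_mixed_extend`
turns an attack on a padded program into one on the original. A cheater who has been cut off still
holds a memory `ℂ^d`, whereas a program must end in `ℂ^1`. `Mixed` supplies the missing discarding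
instrument, which is fused into the preceding message step. Finally `play_le_mul_weight` passes from
cheaters with nothing at the start to cheaters holding an arbitrary vector. The honest case rests on
`play_extend_extend`, `play_andThen_andThen` and `play_eq_of_no_abort`. -/

/-- The expected payoff `w` of the interaction, in which either role may come first. -/
noncomputable def play (w : Outcome → Outcome → ℝ) {me other : Role} : {s : List Message} →
    {d e : ℕ} → Party me s d → Party other s e → (Fin d → Fin e → ℂ) → ℝ
  | _, _, _, .output a, .output b, ψ => w a b * ‖ψ 0 0‖ ^ 2
  | _, _, _, @Party.send _ _ _ _ _ ι _ _ K _ next, @Party.recv _ _ _ _ _ κ _ _ L _ next', ψ =>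
      ∑ k : ι, ∑ l : κ, play w (next k) (next' l) (transmitAB (K k) (L l) ψ)
  | _, _, _, @Party.recv _ _ _ _ _ ι _ _ L _ next, @Party.send _ _ _ _ _ κ _ _ K _ next', ψ =>
      ∑ k : ι, ∑ l : κ, play w (next k) (next' l) (transmitBA (K l) (L k) ψ)
  -- Two senders or two receivers cannot meet when the roles differ. With the default 0, most lemmas
  -- below need no hypothesis `me ≠ other`.
  | _, _, _, @Party.send _ _ _ _ _ _ _ _ _ _ _, @Party.send _ _ _ _ _ _ _ _ _ _ _, _ => 0
  | _, _, _, @Party.recv _ _ _ _ _ _ _ _ _ _ _, @Party.recv _ _ _ _ _ _ _ _ _ _ _, _ => 0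

/-- The payoff that is `1` if the outcome is `c`, and `0` otherwise. -/
def win (c a b : Outcome) : ℝ := if a.joint b = c then 1 else 0

theorem win_nonneg (c a b : Outcome) : 0 ≤ win c a b := by
  unfold win; split <;> norm_num

theorem joint_comm (a b : Outcome) : a.joint b = b.joint a := by
  cases a <;> cases b <;> rfl

theorem run_eq_play (c : Outcome) {s : List Message} {d e : ℕ} (a : Party .alice s d)
    (b : Party .bob s e) (ψ : Fin d → Fin e → ℂ) : run c a b ψ = play (win c) a b ψ := by
  induction a generalizing e with
  | output o => cases b; simp [run, play, win]
  | send hm ι mem K hK next ih =>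
    cases b with
    | send hm' => exact nomatch hm.symm.trans hm'
    | recv => simp only [run, play, ih]
  | @recv m _ _ hm ι _ mem K hK next ih =>
    cases b with
    | send => simp only [run, play, ih]
    | recv hm' => exact absurd (show m.sender = .alice ∨ m.sender = .bob by
        cases m.sender <;> simp) (not_or.mpr ⟨hm, hm'⟩)

/-- Lets every bound on a cheater in the first argument serve for a cheating Bob as well. -/
theorem play_swap (w : Outcome → Outcome → ℝ) {me other : Role} {s : List Message} {d e : ℕ}
    (a : Party me s d) (b : Party other s e) (ψ : Fin d → Fin e → ℂ) :
    play w a b ψ = play (fun x y => w y x) b a (fun j i => ψ i j) := by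
  induction a generalizing e with
  | output o => cases b; simp [play]
  | send hm ι mem K hK next ih =>
    cases b with
    | send => simp [play]
    | recv =>
      simp only [play, ih]
      rw [Finset.sum_comm]
      refine Finset.sum_congr rfl fun l _ => Finset.sum_congr rfl fun k _ => ?_
      congr 1
      funext i' j'
      exact Finset.sum_comm
  | recv hm ι mem K hK next ih =>
    cases b with
    | recv => simp [play]
    | send =>
      simp only [play, ih]
      rw [Finset.sum_comm]
      refine Finset.sum_congr rfl fun l _ => Finset.sum_congr rfl fun k _ => ?_
      congr 1
      funext i' j'
      exact Finset.sum_comm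

theorem prob_eq_play {s : List Message} (a : Party .alice s 1) (b : Party .bob s 1)
    (c : Outcome) : prob a b c = play (win c) a b fun _ _ => 1 :=
  run_eq_play c a b _

theorem prob_eq_play_swap {s : List Message} (a : Party .alice s 1) (b : Party .bob s 1)
    (c : Outcome) : prob a b c = play (win c) b a fun _ _ => 1 := by
  have h : (fun x y => win c y x) = win c := by
    funext x y
    rw [win, win, joint_comm]
  rw [prob_eq_play, play_swap, h]

theorem play_nonneg {w : Outcome → Outcome → ℝ} (hw : ∀ x y, 0 ≤ w x y) {me other : Role}
    {s : List Message} {d e : ℕ} (a : Party me s d) (b : Party other s e)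
    (ψ : Fin d → Fin e → ℂ) : 0 ≤ play w a b ψ := by
  induction a generalizing e with
  | output o => cases b; exact mul_nonneg (hw _ _) (sq_nonneg _)
  | send hm ι mem K hK next ih =>
    cases b with
    | send => simp [play]
    | recv => exact Finset.sum_nonneg fun k _ => Finset.sum_nonneg fun l _ => ih _ _ _
  | recv hm ι mem K hK next ih =>
    cases b with
    | recv => simp [play]
    | send => exact Finset.sum_nonneg fun k _ => Finset.sum_nonneg fun l _ => ih _ _ _

theorem play_add (w w' : Outcome → Outcome → ℝ) {me other : Role}
    {s : List Message} {d e : ℕ} (a : Party me s d) (b : Party other s e)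
    (ψ : Fin d → Fin e → ℂ) :
    play (fun x y => w x y + w' x y) a b ψ = play w a b ψ + play w' a b ψ := by
  induction a generalizing e with
  | output o => cases b; exact add_mul _ _ _
  | send hm ι mem K hK next ih =>
    cases b <;> simp [play, ih, Finset.sum_add_distrib]
  | recv hm ι mem K hK next ih =>
    cases b <;> simp [play, ih, Finset.sum_add_distrib]

theorem play_const_mul (r : ℝ) (w : Outcome → Outcome → ℝ) {me other : Role}
    {s : List Message} {d e : ℕ} (a : Party me s d) (b : Party other s e)
    (ψ : Fin d → Fin e → ℂ) :
    play (fun x y => r * w x y) a b ψ = r * play w a b ψ := by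
  induction a generalizing e with
  | output o => cases b; exact mul_assoc _ _ _
  | send hm ι mem K hK next ih =>
    cases b <;> simp [play, ih, Finset.mul_sum]
  | recv hm ι mem K hK next ih =>
    cases b <;> simp [play, ih, Finset.mul_sum]

theorem transmitAB_smul {d e d' e' x : ℕ} (K : Matrix (Fin d' × Fin x) (Fin d) ℂ)
    (L : Matrix (Fin e') (Fin e × Fin x) ℂ) (r : ℂ) (ψ : Fin d → Fin e → ℂ) :
    transmitAB K L (fun i j => r * ψ i j) = fun i j => r * transmitAB K L ψ i j := by
  funext i' j'
  simp only [transmitAB, Finset.mul_sum, mul_left_comm]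

theorem transmitBA_smul {d e d' e' x : ℕ} (K : Matrix (Fin e' × Fin x) (Fin e) ℂ)
    (L : Matrix (Fin d') (Fin d × Fin x) ℂ) (r : ℂ) (ψ : Fin d → Fin e → ℂ) :
    transmitBA K L (fun i j => r * ψ i j) = fun i j => r * transmitBA K L ψ i j := by
  funext i' j'
  simp only [transmitBA, Finset.mul_sum, mul_left_comm]

theorem play_smul (w : Outcome → Outcome → ℝ) {me other : Role}
    {s : List Message} {d e : ℕ} (a : Party me s d) (b : Party other s e) (r : ℂ)
    (ψ : Fin d → Fin e → ℂ) :
    play w a b (fun i j => r * ψ i j) = ‖r‖ ^ 2 * play w a b ψ := by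
  induction a generalizing e with
  | output o => cases b; simp only [play, norm_mul]; ring
  | send hm ι mem K hK next ih =>
    cases b <;> simp [play, ih, Finset.mul_sum, transmitAB_smul]
  | recv hm ι mem K hK next ih =>
    cases b <;> simp [play, ih, Finset.mul_sum, transmitBA_smul]

theorem play_zero (w : Outcome → Outcome → ℝ) {me other : Role}
    {s : List Message} {d e : ℕ} (a : Party me s d) (b : Party other s e) :
    play w a b (fun _ _ => 0) = 0 := by
  simpa using play_smul w a b 0 fun _ _ => 0

/-! ### Conservation of probability -/

/-- The squared norm of a joint vector. -/
noncomputable def weight {d e : ℕ} (ψ : Fin d → Fin e → ℂ) : ℝ := ∑ i, ∑ j, ‖ψ i j‖ ^ 2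

theorem weight_nonneg {d e : ℕ} (ψ : Fin d → Fin e → ℂ) : 0 ≤ weight ψ :=
  Finset.sum_nonneg fun _ _ => Finset.sum_nonneg fun _ _ => sq_nonneg _

theorem weight_one : weight (fun (_ _ : Fin 1) => (1 : ℂ)) = 1 := by simp [weight]

theorem sum_norm_sq_eq_dotProduct {α : Type*} [Fintype α] (v : α → ℂ) :
    ((∑ i, ‖v i‖ ^ 2 : ℝ) : ℂ) = star v ⬝ᵥ v := by
  simp [dotProduct, ← Complex.conj_mul']

/-- Each squared norm is `v† K† K v`, and the completeness relation sums these to `v† v`. -/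
theorem sum_norm_sq_mulVec {ι : Type*} [Fintype ι] {α : Type*} [Fintype α] [DecidableEq α]
    {β : ι → Type*} [∀ k, Fintype (β k)] (K : (k : ι) → Matrix (β k) α ℂ)
    (hK : ∑ k, (K k)ᴴ * K k = 1) (v : α → ℂ) :
    ∑ k, ∑ i, ‖(K k *ᵥ v) i‖ ^ 2 = ∑ i, ‖v i‖ ^ 2 := by
  apply Complex.ofReal_injective
  rw [Complex.ofReal_sum]
  simp only [sum_norm_sq_eq_dotProduct, Matrix.star_mulVec, ← Matrix.dotProduct_mulVec,
    Matrix.mulVec_mulVec]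
  rw [← dotProduct_sum, ← Matrix.sum_mulVec, hK, Matrix.one_mulVec]

/-- Completeness of `L` is used at each fixed index of the sender's new memory, then completeness of
`K` at each fixed index of the receiver's old memory. -/
theorem sum_weight_transmitAB {d e x : ℕ} {ι κ : Type} [Fintype ι] [Fintype κ] {mem : ι → ℕ}
    {mem' : κ → ℕ} (K : (k : ι) → Matrix (Fin (mem k) × Fin x) (Fin d) ℂ)
    (hK : ∑ k, (K k)ᴴ * K k = 1) (L : (l : κ) → Matrix (Fin (mem' l)) (Fin e × Fin x) ℂ)
    (hL : ∑ l, (L l)ᴴ * L l = 1) (ψ : Fin d → Fin e → ℂ) :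
    ∑ k, ∑ l, weight (transmitAB (K k) (L l) ψ) = weight ψ := by
  have h1 : ∀ k, ∑ l, weight (transmitAB (K k) (L l) ψ) =
      ∑ i', ∑ p : Fin e × Fin x, ‖(K k *ᵥ fun i => ψ i p.1) (i', p.2)‖ ^ 2 := by
    intro k
    simp only [weight]
    rw [Finset.sum_comm]
    refine Finset.sum_congr rfl fun i' _ => ?_
    rw [← sum_norm_sq_mulVec L hL]
    refine Finset.sum_congr rfl fun l _ => Finset.sum_congr rfl fun j' _ => ?_
    congr 2
    simp only [transmitAB, Matrix.mulVec, dotProduct, Fintype.sum_prod_type, Finset.mul_sum]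
    rw [Finset.sum_comm]
    refine Finset.sum_congr rfl fun j _ => ?_
    rw [Finset.sum_comm]
    refine Finset.sum_congr rfl fun m _ => Finset.sum_congr rfl fun i _ => by ring
  simp only [h1]
  have h2 : weight ψ = ∑ j, ∑ i, ‖ψ i j‖ ^ 2 := Finset.sum_comm
  rw [h2]
  simp only [← sum_norm_sq_mulVec K hK, Fintype.sum_prod_type]
  rw [Finset.sum_comm (s := (Finset.univ : Finset (Fin e)))]
  refine Finset.sum_congr rfl fun k _ => ?_
  rw [Finset.sum_comm]

theorem weight_swap {d e : ℕ} (ψ : Fin d → Fin e → ℂ) :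
    weight (fun j i => ψ i j) = weight ψ := Finset.sum_comm

theorem transmitBA_swap {d e d' e' x : ℕ} (K : Matrix (Fin e' × Fin x) (Fin e) ℂ)
    (L : Matrix (Fin d') (Fin d × Fin x) ℂ) (ψ : Fin d → Fin e → ℂ) :
    transmitBA K L ψ = fun i j => transmitAB K L (fun j i => ψ i j) j i := by
  funext i' j'
  exact Finset.sum_comm

theorem sum_weight_transmitBA {d e x : ℕ} {ι κ : Type} [Fintype ι] [Fintype κ] {mem : ι → ℕ}
    {mem' : κ → ℕ} (L : (k : ι) → Matrix (Fin (mem k)) (Fin d × Fin x) ℂ)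
    (hL : ∑ k, (L k)ᴴ * L k = 1) (K : (l : κ) → Matrix (Fin (mem' l) × Fin x) (Fin e) ℂ)
    (hK : ∑ l, (K l)ᴴ * K l = 1) (ψ : Fin d → Fin e → ℂ) :
    ∑ k, ∑ l, weight (transmitBA (K l) (L k) ψ) = weight ψ := by
  rw [Finset.sum_comm, ← weight_swap ψ, ← sum_weight_transmitAB K hK L hL]
  refine Finset.sum_congr rfl fun l _ => Finset.sum_congr rfl fun k _ => ?_
  rw [transmitBA_swap, weight_swap]

/-- Every exchange conserves the weight. Distinct roles are essential here, since the default value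
0 of `play` would lose it. -/
theorem play_const (r : ℝ) {me other : Role} (hne : me ≠ other) {s : List Message} {d e : ℕ}
    (a : Party me s d) (b : Party other s e) (ψ : Fin d → Fin e → ℂ) :
    play (fun _ _ => r) a b ψ = r * weight ψ := by
  induction a generalizing e with
  | output o => cases b; simp [play, weight]
  | send hm ι mem K hK next ih =>
    cases b with
    | send hm' => exact absurd (hm.symm.trans hm') hne
    | recv hm' κ mem' L hL next' =>
      simp only [play, ih, ← Finset.mul_sum, sum_weight_transmitAB K hK L hL]
  | @recv m _ _ hm ι _ mem L hL next ih =>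
    cases b with
    | send hm' κ mem' K hK next' =>
      simp only [play, ih, ← Finset.mul_sum, sum_weight_transmitBA L hL K hK]
    | recv hm' =>
      refine absurd ?_ hne
      cases h : m.sender <;> cases me <;> cases other <;> simp_all

/-! ### Local operations and messages -/

/-- The action of a matrix on the first memory of a joint vector. -/
noncomputable def act {d d' e : ℕ} (J : Matrix (Fin d') (Fin d) ℂ) (ψ : Fin d → Fin e → ℂ) :
    Fin d' → Fin e → ℂ := fun i' j => ∑ i, J i' i * ψ i j

theorem act_one {d e : ℕ} (ψ : Fin d → Fin e → ℂ) : act 1 ψ = ψ := by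
  funext i j
  simp [act, Matrix.one_apply]

theorem sum_weight_act {d e : ℕ} {ι : Type} [Fintype ι] {mem : ι → ℕ}
    (J : (k : ι) → Matrix (Fin (mem k)) (Fin d) ℂ) (hJ : ∑ k, (J k)ᴴ * J k = 1)
    (ψ : Fin d → Fin e → ℂ) : ∑ k, weight (act (J k) ψ) = weight ψ := by
  have h : weight ψ = ∑ j, ∑ i, ‖ψ i j‖ ^ 2 := Finset.sum_comm
  rw [h]
  simp only [← sum_norm_sq_mulVec J hJ, weight]
  rw [Finset.sum_comm]
  exact Finset.sum_congr rfl fun k _ => Finset.sum_comm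

/-- Apply `J` to the memory after emitting a message with `K`. -/
noncomputable def actSend {d d' d'' x : ℕ} (J : Matrix (Fin d'') (Fin d') ℂ)
    (K : Matrix (Fin d' × Fin x) (Fin d) ℂ) : Matrix (Fin d'' × Fin x) (Fin d) ℂ :=
  (J ⊗ₖ (1 : Matrix (Fin x) (Fin x) ℂ)) * K

theorem actSend_apply {d d' d'' x : ℕ} (J : Matrix (Fin d'') (Fin d') ℂ)
    (K : Matrix (Fin d' × Fin x) (Fin d) ℂ) (i'' : Fin d'') (q : Fin x) (i : Fin d) :
    actSend J K (i'', q) i = ∑ i', J i'' i' * K (i', q) i := by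
  simp [actSend, Matrix.mul_apply, Fintype.sum_prod_type, Matrix.one_apply]

theorem sum_kronecker_one_gram {d x : ℕ} {ι : Type} [Fintype ι] {mem : ι → ℕ}
    (J : (k : ι) → Matrix (Fin (mem k)) (Fin d) ℂ) (hJ : ∑ k, (J k)ᴴ * J k = 1) :
    ∑ k, (J k ⊗ₖ (1 : Matrix (Fin x) (Fin x) ℂ))ᴴ * (J k ⊗ₖ (1 : Matrix (Fin x) (Fin x) ℂ)) = 1 := by
  have h : ∀ k, (J k ⊗ₖ (1 : Matrix (Fin x) (Fin x) ℂ))ᴴ *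
      (J k ⊗ₖ (1 : Matrix (Fin x) (Fin x) ℂ)) = ((J k)ᴴ * J k) ⊗ₖ 1 := fun k => by
    rw [Matrix.conjTranspose_kronecker, ← Matrix.mul_kronecker_mul]
    simp
  simp only [h]
  rw [← Matrix.one_kronecker_one, ← hJ]
  ext p q
  simp [Matrix.sum_apply, Finset.sum_mul]

/-- The second instrument may depend on the result of the first; this makes the fused steps of
`Mixed` legal instruments. -/
theorem sum_gram_comp {α : Type*} [Fintype α] [DecidableEq α] {ι : Type*} [Fintype ι]
    {β : ι → Type*} [∀ k, Fintype (β k)] [∀ k, DecidableEq (β k)] {κ : ι → Type*}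
    [∀ k, Fintype (κ k)] {γ : (k : ι) → κ k → Type*} [∀ k l, Fintype (γ k l)]
    (K : (k : ι) → Matrix (β k) α ℂ) (hK : ∑ k, (K k)ᴴ * K k = 1)
    (J : (k : ι) → (l : κ k) → Matrix (γ k l) (β k) ℂ)
    (hJ : ∀ k, ∑ l, (J k l)ᴴ * J k l = 1) :
    ∑ p : Σ k, κ k, (J p.1 p.2 * K p.1)ᴴ * (J p.1 p.2 * K p.1) = 1 := by
  rw [Fintype.sum_sigma, ← hK]
  refine Finset.sum_congr rfl fun k _ => ?_
  have h : ∀ l, (J k l * K k)ᴴ * (J k l * K k) = (K k)ᴴ * ((J k l)ᴴ * J k l) * K k := fun l => by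
    simp only [Matrix.conjTranspose_mul, Matrix.mul_assoc]
  simp only [h]
  rw [← Matrix.sum_mul, ← Matrix.mul_sum, hJ, Matrix.mul_one]

/-- An operation on the sender's remaining memory commutes with the delivery of the message, so it
may be performed before sending. -/
theorem transmitAB_actSend {d d' d'' e e' x : ℕ} (J : Matrix (Fin d'') (Fin d') ℂ)
    (K : Matrix (Fin d' × Fin x) (Fin d) ℂ) (L : Matrix (Fin e') (Fin e × Fin x) ℂ)
    (ψ : Fin d → Fin e → ℂ) :
    transmitAB (actSend J K) L ψ = act J (transmitAB K L ψ) := by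
  funext i'' j'
  simp only [transmitAB, act, actSend_apply, Finset.mul_sum, Finset.sum_mul]
  refine Eq.trans (Finset.sum_congr rfl fun i _ => ?_) Finset.sum_comm
  refine Eq.trans (Finset.sum_congr rfl fun j _ => ?_) Finset.sum_comm
  refine Eq.trans (Finset.sum_congr rfl fun m _ => ?_) Finset.sum_comm
  exact Finset.sum_congr rfl fun i' _ => by ring

theorem transmitBA_mul {d d' d'' e e' x : ℕ} (J : Matrix (Fin d'') (Fin d') ℂ)
    (K : Matrix (Fin e' × Fin x) (Fin e) ℂ) (L : Matrix (Fin d') (Fin d × Fin x) ℂ)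
    (ψ : Fin d → Fin e → ℂ) :
    transmitBA K (J * L) ψ = act J (transmitBA K L ψ) := by
  funext i'' j'
  simp only [transmitBA, act, Matrix.mul_apply, Finset.mul_sum, Finset.sum_mul]
  refine Eq.trans (Finset.sum_congr rfl fun i _ => ?_) Finset.sum_comm
  refine Eq.trans (Finset.sum_congr rfl fun j _ => ?_) Finset.sum_comm
  refine Eq.trans (Finset.sum_congr rfl fun m _ => ?_) Finset.sum_comm
  exact Finset.sum_congr rfl fun i' _ => by ring

/-- Condition a Kraus operator that emits a message in `ℂ^y` on the message being in `ℂ^x`. -/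
def restrictSend {d d' x y : ℕ} (h : x ≤ y) (K : Matrix (Fin d' × Fin y) (Fin d) ℂ) :
    Matrix (Fin d' × Fin x) (Fin d) ℂ :=
  fun p i => K (p.1, Fin.castLE h p.2) i

/-- Restrict a Kraus operator that takes a message in `ℂ^y` to messages in `ℂ^x`. -/
def restrictRecv {d d' x y : ℕ} (h : x ≤ y) (L : Matrix (Fin d') (Fin d × Fin y) ℂ) :
    Matrix (Fin d') (Fin d × Fin x) ℂ :=
  fun i p => L i (p.1, Fin.castLE h p.2)

/-- The Kraus operators that detect that `K` emits a message outside `ℂ^x`, discard memory and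
message, and send a fixed basis state instead. -/
def rejectSend {d d' x y : ℕ} (K : Matrix (Fin d' × Fin y) (Fin d) ℂ) (p : Fin d' × Fin y) :
    Matrix (Fin 1 × Fin x) (Fin d) ℂ :=
  fun q i => if q.2.val = 0 ∧ x ≤ p.2.val then K p i else 0

/-- A principal submatrix of the identity is the identity. -/
theorem restrictRecv_complete {d x y : ℕ} (h : x ≤ y) {ι : Type} [Fintype ι] {mem : ι → ℕ}
    (L : (k : ι) → Matrix (Fin (mem k)) (Fin d × Fin y) ℂ) (hL : ∑ k, (L k)ᴴ * L k = 1) :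
    ∑ k, (restrictRecv h (L k))ᴴ * restrictRecv h (L k) = 1 := by
  ext ⟨i, q⟩ ⟨j, r⟩
  have := congrFun (congrFun hL (i, Fin.castLE h q)) (j, Fin.castLE h r)
  rw [Matrix.sum_apply] at this ⊢
  simpa [restrictRecv, Matrix.mul_apply, Matrix.one_apply, Fin.ext_iff] using this

theorem sum_castLE_add_sum_ge {x y : ℕ} (h : x ≤ y) (f : Fin y → ℂ) :
    (∑ q : Fin x, f (Fin.castLE h q)) + ∑ q : Fin y, (if x ≤ q.val then f q else 0) = ∑ q, f q := by
  rw [← sum_dite_lt h, ← Finset.sum_add_distrib]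
  refine Finset.sum_congr rfl fun q _ => ?_
  by_cases hq : q.val < x
  · simp [hq, not_le.mpr hq]
  · simp [hq, not_lt.mp hq]

/-- For each memory index the sum over `ℂ^y` splits at `x`: the lower part is kept, and each basis
state of the upper part gets its own rejecting operator. The replacement message is basis state 0,
whence `0 < x`. -/
theorem restrictSend_complete {d x y : ℕ} (hx : 0 < x) (h : x ≤ y) {ι : Type} [Fintype ι]
    {mem : ι → ℕ} (K : (k : ι) → Matrix (Fin (mem k) × Fin y) (Fin d) ℂ)
    (hK : ∑ k, (K k)ᴴ * K k = 1) :
    (∑ k, (restrictSend h (K k))ᴴ * restrictSend h (K k)) +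
      ∑ p : Σ k, Fin (mem k) × Fin y,
        (rejectSend (x := x) (K p.1) p.2)ᴴ * rejectSend (x := x) (K p.1) p.2 = 1 := by
  rw [Fintype.sum_sigma, ← Finset.sum_add_distrib, ← hK]
  refine Finset.sum_congr rfl fun k _ => ?_
  ext i j
  rw [Matrix.add_apply, Matrix.sum_apply]
  simp only [Matrix.mul_apply, Matrix.conjTranspose_apply, Fintype.sum_prod_type]
  rw [← Finset.sum_add_distrib]
  refine Finset.sum_congr rfl fun a _ => ?_
  refine Eq.trans (congrArg₂ _ rfl ?_) 
    (sum_castLE_add_sum_ge h fun q => star (K k (a, q) i) * K k (a, q) j)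
  refine Finset.sum_congr rfl fun q _ => ?_
  have h0 : ∀ q : Fin x, (q : ℕ) = 0 ↔ q = ⟨0, hx⟩ := fun q => by rw [Fin.ext_iff]
  by_cases hq : x ≤ q.val <;> simp [rejectSend, hq, h0]

/-- The receiver's projection onto `ℂ^x` is moved to the sender, who can then run on the smaller
message space. -/
theorem transmitAB_embedRecv {d e d' e' x y : ℕ} (h : x ≤ y)
    (K : Matrix (Fin d' × Fin y) (Fin d) ℂ) (L : Matrix (Fin e') (Fin e × Fin x) ℂ)
    (ψ : Fin d → Fin e → ℂ) :
    transmitAB K (embedRecv L) ψ = transmitAB (restrictSend h K) L ψ := by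
  funext i' j'
  simp only [transmitAB]
  refine Finset.sum_congr rfl fun i _ => Finset.sum_congr rfl fun j _ => ?_
  rw [← sum_dite_lt h]
  refine Finset.sum_congr rfl fun q _ => ?_
  by_cases hq : q.val < x <;> simp [embedRecv, restrictSend, hq]

theorem transmitBA_embedSend {d e d' e' x y : ℕ} (h : x ≤ y)
    (K : Matrix (Fin e' × Fin x) (Fin e) ℂ) (L : Matrix (Fin d') (Fin d × Fin y) ℂ)
    (ψ : Fin d → Fin e → ℂ) :
    transmitBA (embedSend K) L ψ = transmitBA K (restrictRecv h L) ψ := by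
  funext i' j'
  simp only [transmitBA]
  refine Finset.sum_congr rfl fun i _ => Finset.sum_congr rfl fun j _ => ?_
  rw [← sum_dite_lt h]
  refine Finset.sum_congr rfl fun q _ => ?_
  by_cases hq : q.val < x <;> simp [embedSend, restrictRecv, hq]

theorem restrictSend_embedSend {d d' x y : ℕ} (h : x ≤ y)
    (K : Matrix (Fin d' × Fin x) (Fin d) ℂ) : restrictSend h (embedSend K) = K := by
  ext p i
  simp [restrictSend, embedSend]

theorem transmitAB_embed {d e d' e' x y : ℕ} (h : x ≤ y)
    (K : Matrix (Fin d' × Fin x) (Fin d) ℂ) (L : Matrix (Fin e') (Fin e × Fin x) ℂ)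
    (ψ : Fin d → Fin e → ℂ) :
    transmitAB (embedSend (y := y) K) (embedRecv L) ψ = transmitAB K L ψ := by
  rw [transmitAB_embedRecv h, restrictSend_embedSend]

theorem transmitAB_rejectRecv {d e d' x y : ℕ}
    (K : Matrix (Fin d' × Fin x) (Fin d) ℂ) (p : Fin e × Fin y) (ψ : Fin d → Fin e → ℂ) :
    transmitAB (embedSend (y := y) K) (rejectRecv (x := x) p) ψ = fun _ _ => 0 := by
  funext i' j'
  refine Finset.sum_eq_zero fun i _ => Finset.sum_eq_zero fun j _ =>
    Finset.sum_eq_zero fun q _ => ?_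
  by_cases hq : q.val < x
  · have : ¬ ((j, q) = p ∧ x ≤ p.2.val) := by
      rintro ⟨rfl, hp⟩
      exact absurd hq (not_lt.mpr hp)
    simp [rejectRecv, this]
  · simp [embedSend, hq]

/-! ### Instruments followed by programs -/

/-- An instrument on a memory `ℂ^d`, followed by a program that depends on its result. -/
structure Mixed (me : Role) (s : List Message) (d : ℕ) where
  ι : Type
  [fintype : Fintype ι]
  mem : ι → ℕ
  J : (k : ι) → Matrix (Fin (mem k)) (Fin d) ℂ
  complete : ∑ k, (J k)ᴴ * J k = 1
  next : (k : ι) → Party me s (mem k)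

attribute [instance] Mixed.fintype

/-- The expected payoff when a player starts with an instrument. -/
noncomputable def Mixed.play (w : Outcome → Outcome → ℝ) {me other : Role} {s : List Message}
    {d e : ℕ} (M : Mixed me s d) (b : Party other s e) (ψ : Fin d → Fin e → ℂ) : ℝ :=
  ∑ k, CoinFlipping.play w (M.next k) b (act (M.J k) ψ)

theorem Mixed.play_nonneg {w : Outcome → Outcome → ℝ} (hw : ∀ x y, 0 ≤ w x y) {me other : Role}
    {s : List Message} {d e : ℕ} (M : Mixed me s d) (b : Party other s e)
    (ψ : Fin d → Fin e → ℂ) : 0 ≤ M.play w b ψ :=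
  Finset.sum_nonneg fun _ _ => CoinFlipping.play_nonneg hw _ _ _

/-- A program, preceded by the trivial instrument. -/
noncomputable def Mixed.ofParty {me : Role} {s : List Message} {d : ℕ} (a : Party me s d) :
    Mixed me s d where
  ι := Unit
  mem _ := d
  J _ := 1
  complete := by simp
  next _ := a

theorem Mixed.ofParty_play (w : Outcome → Outcome → ℝ) {me other : Role} {s : List Message}
    {d e : ℕ} (a : Party me s d) (b : Party other s e) (ψ : Fin d → Fin e → ℂ) :
    (Mixed.ofParty a).play w b ψ = CoinFlipping.play w a b ψ := by
  simp only [Mixed.play, Mixed.ofParty, act_one]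
  exact Fintype.sum_unique _

/-- Discard the memory and announce `o`. -/
noncomputable def Mixed.output {me : Role} (d : ℕ) (o : Outcome) : Mixed me [] d where
  ι := Fin d
  mem _ := 1
  J i := Matrix.of fun _ j => if j = i then 1 else 0
  complete := by
    ext i j
    simp [Matrix.sum_apply, Matrix.mul_apply, Matrix.one_apply, eq_comm]
  next _ := .output o

theorem Mixed.output_play (w : Outcome → Outcome → ℝ) {me other : Role} (d : ℕ) (o o' : Outcome)
    (ψ : Fin d → Fin 1 → ℂ) :
    (Mixed.output (me := me) d o).play w (.output o' : Party other [] 1) ψ =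
      w o o' * weight ψ := by
  simp [Mixed.play, Mixed.output, CoinFlipping.play, act, weight, Finset.mul_sum]
  rfl

/-- Send a message and go on with an instrument. -/
noncomputable def Party.sendMixed {me : Role} {m : Message} {s : List Message} {d : ℕ}
    (hm : m.sender = me) (ι : Type) [Fintype ι] (mem : ι → ℕ)
    (K : (k : ι) → Matrix (Fin (mem k) × Fin m.dim) (Fin d) ℂ) (hK : ∑ k, (K k)ᴴ * K k = 1)
    (M : (k : ι) → Mixed me s (mem k)) : Party me (m :: s) d :=
  .send hm (Σ k, (M k).ι) (fun p => (M p.1).mem p.2)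
    (fun p => actSend ((M p.1).J p.2) (K p.1))
    (sum_gram_comp K hK (fun k l => (M k).J l ⊗ₖ 1) fun k =>
      sum_kronecker_one_gram _ (M k).complete)
    fun p => (M p.1).next p.2

/-- Receive a message and go on with an instrument. -/
noncomputable def Party.recvMixed {me : Role} {m : Message} {s : List Message} {d : ℕ}
    (hm : m.sender ≠ me) (ι : Type) [Fintype ι] (mem : ι → ℕ)
    (L : (k : ι) → Matrix (Fin (mem k)) (Fin d × Fin m.dim) ℂ) (hL : ∑ k, (L k)ᴴ * L k = 1)
    (M : (k : ι) → Mixed me s (mem k)) : Party me (m :: s) d :=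
  .recv hm (Σ k, (M k).ι) (fun p => (M p.1).mem p.2) (fun p => (M p.1).J p.2 * L p.1)
    (sum_gram_comp L hL (fun k l => (M k).J l) fun k => (M k).complete)
    fun p => (M p.1).next p.2

theorem play_sendMixed (w : Outcome → Outcome → ℝ) {me other : Role} {m : Message}
    {s : List Message} {d e : ℕ} (hm : m.sender = me) (ι : Type) [Fintype ι] (mem : ι → ℕ)
    (K : (k : ι) → Matrix (Fin (mem k) × Fin m.dim) (Fin d) ℂ) (hK : ∑ k, (K k)ᴴ * K k = 1)
    (M : (k : ι) → Mixed me s (mem k)) (hm' : m.sender ≠ other) (κ : Type) [Fintype κ]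
    (mem' : κ → ℕ) (L : (l : κ) → Matrix (Fin (mem' l)) (Fin e × Fin m.dim) ℂ)
    (hL : ∑ l, (L l)ᴴ * L l = 1) (next : (l : κ) → Party other s (mem' l))
    (ψ : Fin d → Fin e → ℂ) :
    play w (.sendMixed hm ι mem K hK M) (.recv hm' κ mem' L hL next) ψ =
      ∑ k, ∑ l, (M k).play w (next l) (transmitAB (K k) (L l) ψ) := by
  have h : play w (.sendMixed hm ι mem K hK M) (.recv hm' κ mem' L hL next) ψ =
      ∑ p : Σ k, (M k).ι, ∑ l, play w ((M p.1).next p.2) (next l)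
        (transmitAB (actSend ((M p.1).J p.2) (K p.1)) (L l) ψ) := by
    rfl
  simp only [h, Mixed.play, Fintype.sum_sigma, transmitAB_actSend]
  exact Finset.sum_congr rfl fun k _ => Finset.sum_comm

theorem play_recvMixed (w : Outcome → Outcome → ℝ) {me other : Role} {m : Message}
    {s : List Message} {d e : ℕ} (hm : m.sender ≠ me) (ι : Type) [Fintype ι] (mem : ι → ℕ)
    (L : (k : ι) → Matrix (Fin (mem k)) (Fin d × Fin m.dim) ℂ) (hL : ∑ k, (L k)ᴴ * L k = 1)
    (M : (k : ι) → Mixed me s (mem k)) (hm' : m.sender = other) (κ : Type) [Fintype κ]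
    (mem' : κ → ℕ) (K : (l : κ) → Matrix (Fin (mem' l) × Fin m.dim) (Fin e) ℂ)
    (hK : ∑ l, (K l)ᴴ * K l = 1) (next : (l : κ) → Party other s (mem' l))
    (ψ : Fin d → Fin e → ℂ) :
    play w (.recvMixed hm ι mem L hL M) (.send hm' κ mem' K hK next) ψ =
      ∑ k, ∑ l, (M k).play w (next l) (transmitBA (K l) (L k) ψ) := by
  simp only [Party.recvMixed, play, Mixed.play, Fintype.sum_sigma, transmitBA_mul]
  exact Finset.sum_congr rfl fun k _ => Finset.sum_comm

/-! ### Simulating a cheater on a shorter schedule -/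

theorem play_send_recv_le {w : Outcome → Outcome → ℝ} {me other : Role} {m : Message}
    {s : List Message} {d e : ℕ} {hm : m.sender = me} {ι : Type} [Fintype ι] {mem : ι → ℕ}
    {K : (k : ι) → Matrix (Fin (mem k) × Fin m.dim) (Fin d) ℂ} {hK : ∑ k, (K k)ᴴ * K k = 1}
    {next : (k : ι) → Party me s (mem k)} {hm' : m.sender ≠ other} {κ : Type} [Fintype κ]
    {mem' : κ → ℕ} {L : (l : κ) → Matrix (Fin (mem' l)) (Fin e × Fin m.dim) ℂ}
    {hL : ∑ l, (L l)ᴴ * L l = 1} {next' : (l : κ) → Party other s (mem' l)} {C : ℝ}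
    (h : ∀ k l φ, play w (next k) (next' l) φ ≤ C * weight φ) (ψ : Fin d → Fin e → ℂ) :
    play w (.send hm ι mem K hK next) (.recv hm' κ mem' L hL next') ψ ≤ C * weight ψ := by
  rw [← sum_weight_transmitAB K hK L hL, Finset.mul_sum, play]
  refine Finset.sum_le_sum fun k _ => ?_
  rw [Finset.mul_sum]
  exact Finset.sum_le_sum fun l _ => h k l _

theorem play_recv_send_le {w : Outcome → Outcome → ℝ} {me other : Role} {m : Message}
    {s : List Message} {d e : ℕ} {hm : m.sender ≠ me} {ι : Type} [Fintype ι] {mem : ι → ℕ}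
    {L : (k : ι) → Matrix (Fin (mem k)) (Fin d × Fin m.dim) ℂ} {hL : ∑ k, (L k)ᴴ * L k = 1}
    {next : (k : ι) → Party me s (mem k)} {hm' : m.sender = other} {κ : Type} [Fintype κ]
    {mem' : κ → ℕ} {K : (l : κ) → Matrix (Fin (mem' l) × Fin m.dim) (Fin e) ℂ}
    {hK : ∑ l, (K l)ᴴ * K l = 1} {next' : (l : κ) → Party other s (mem' l)} {C : ℝ}
    (h : ∀ k l φ, play w (next k) (next' l) φ ≤ C * weight φ) (ψ : Fin d → Fin e → ℂ) :
    play w (.recv hm ι mem L hL next) (.send hm' κ mem' K hK next') ψ ≤ C * weight ψ := by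
  rw [← sum_weight_transmitBA L hL K hK, Finset.mul_sum, play]
  refine Finset.sum_le_sum fun k _ => ?_
  rw [Finset.mul_sum]
  exact Finset.sum_le_sum fun l _ => h k l _

theorem play_idle_le {w : Outcome → Outcome → ℝ} {C : ℝ} (hC : 0 ≤ C) {o : Outcome}
    (hw : ∀ o', w o' o ≤ C) {me other : Role} {t : List Message} {d : ℕ} (a : Party me t d)
    (ψ : Fin d → Fin 1 → ℂ) :
    play w a (Party.idle o t : Party other t 1) ψ ≤ C * weight ψ := by
  induction a with
  | output o' =>
    simpa [Party.idle, play, weight] using mul_le_mul_of_nonneg_right (hw o') (sq_nonneg _)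
  | send hm ι mem K hK next ih =>
    rw [Party.idle]
    split
    · simpa [play] using mul_nonneg hC (weight_nonneg ψ)
    · exact play_send_recv_le (fun k _ φ => ih k φ) ψ
  | recv hm ι mem K hK next ih =>
    rw [Party.idle]
    split
    · exact play_recv_send_le (fun k _ φ => ih k φ) ψ
    · simpa [play] using mul_nonneg hC (weight_nonneg ψ)

/-- Whatever the opponent outputs, announcing the desired value is optimal. This fails for `abort`,
which disagreement also produces. -/
theorem win_le_win_self {c : Outcome} (hc : c ≠ .abort) (o' o : Outcome) :
    win c o' o ≤ win c c o := by
  cases c <;> cases o' <;> cases o <;> simp_all [win, Outcome.joint]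

theorem win_abort {c : Outcome} (hc : c ≠ .abort) (o : Outcome) : win c o .abort = 0 := by
  cases c <;> cases o <;> simp_all [win, Outcome.joint]

/-- Whatever a cheater achieves against an extended program is achieved against the program. -/
theorem exists_mixed_extend {c : Outcome} (hc : c ≠ .abort) {me other : Role} :
    ∀ (s t : List Message) (h : Fits s t) {d : ℕ} (a : Party me t d), ∃ M : Mixed me s d,
      ∀ (e : ℕ) (b : Party other s e) (ψ : Fin d → Fin e → ℂ),
        play (win c) a (b.extend t h) ψ ≤ M.play (win c) b ψ
  -- The opponent only idles from here on with a fixed output, so nothing beats discarding the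
  -- memory and announcing `c`.
  | [], t, h, d, a => ⟨Mixed.output d c, fun e b ψ => by
      cases b with
      | output o =>
        rw [Mixed.output_play, Party.extend]
        exact play_idle_le (win_nonneg _ _ _) (fun o' => win_le_win_self hc o' o) a ψ⟩
  | _ :: _, [], h, _, _ => h.elim
  | m :: s, m' :: t, h, d, a => by
    cases a with
    | send hm ι mem K hK next =>
      -- The simulation does not depend on the opponent, so one choice per own result `k` serves all
      -- of the opponent's branches.
      choose M hM using fun k => exists_mixed_extend hc (other := other) s t h.2.2 (next k)
      refine ⟨.ofParty (.sendMixed (h.1.trans hm) (ι ⊕ Σ k, Fin (mem k) × Fin m'.dim)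
        (Sum.elim mem fun _ => 1)
        (fun k => match k with
          | .inl k => restrictSend h.2.1 (K k)
          | .inr p => rejectSend (K p.1) p.2)
        (by
          rw [Fintype.sum_sum_type]
          exact restrictSend_complete m.dim.pos h.2.1 K hK)
        (fun k => match k with
          | .inl k => M k
          -- Any continuation would do: only nonnegativity of its payoff is used.
          | .inr _ => .ofParty (.idle .abort s))), fun e b ψ => ?_⟩
      rw [Mixed.ofParty_play]
      cases b with
      | send => exact le_of_eq_of_le (b := 0) rfl (play_nonneg (win_nonneg c) _ _ _)
      | recv hm' κ mem' L hL next' =>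
        rw [play_sendMixed, Fintype.sum_sum_type, Party.extend, play]
        refine le_trans (Finset.sum_le_sum fun k _ => ?_) (le_add_of_nonneg_right
          (Finset.sum_nonneg fun p _ => Finset.sum_nonneg fun l _ =>
            Mixed.play_nonneg (win_nonneg c) _ _ _))
        rw [Fintype.sum_sum_type]
        refine (add_le_of_le_of_nonpos (Finset.sum_le_sum fun l _ => ?_)
          (Finset.sum_nonpos fun p _ => ?_))
        · exact (hM k _ (next' l) (transmitAB (K k) (embedRecv (L l)) ψ)).trans_eq
            (congrArg (Mixed.play (win c) (M k) (next' l)) (transmitAB_embedRecv h.2.1 _ _ _))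
        -- An opponent who has rejected a message will abort, so these branches of the original
        -- attack win nothing.
        · exact (play_idle_le le_rfl (fun o' => (win_abort hc o').le) _ _).trans_eq (zero_mul _)
    | recv hm ι mem L hL next =>
      choose M hM using fun k => exists_mixed_extend hc (other := other) s t h.2.2 (next k)
      refine ⟨.ofParty (.recvMixed (fun h' => hm (h.1.symm.trans h')) ι mem
        (fun k => restrictRecv h.2.1 (L k)) (restrictRecv_complete h.2.1 L hL) M),
        fun e b ψ => ?_⟩
      rw [Mixed.ofParty_play]
      cases b with
      | recv =>
        rw [Party.extend, play]
        exact play_nonneg (win_nonneg c) _ _ _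
      | send hm' κ mem' K hK next' =>
        refine le_trans ?_ (play_recvMixed (win c) _ ι mem _ _ M hm' κ mem' K hK next' ψ).ge
        refine Finset.sum_le_sum fun k _ => Finset.sum_le_sum fun l _ => ?_
        exact (hM k _ (next' l) (transmitBA (embedSend (K l)) (L k) ψ)).trans_eq
          (congrArg (Mixed.play (win c) (M k) (next' l)) (transmitBA_embedSend h.2.1 _ _ _))

/-- Truncation of a cheater to the first phase of a sequential composition: the payoff is bounded
by the probability with which the truncated cheater makes the opponent output `c`. -/
theorem exists_mixed_andThen {w : Outcome → Outcome → ℝ} {c : Outcome} {me other : Role}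
    {t : List Message} {f : Outcome → Party other t 1} {α β : ℝ} (hα : 0 ≤ α) (hβ : 0 ≤ β)
    (hf : ∀ (o : Outcome) (d : ℕ) (a : Party me t d) (ψ : Fin d → Fin 1 → ℂ),
      play w a (f o) ψ ≤ (α + β * win c c o) * weight ψ) :
    ∀ (s : List Message) {d : ℕ} (a : Party me (s ++ t) d), ∃ M : Mixed me s d,
      ∀ (e : ℕ) (b : Party other s e) (ψ : Fin d → Fin e → ℂ),
        play w a (b.andThen f) ψ ≤ α * weight ψ + β * M.play (win c) b ψ
  | [], d, a => ⟨Mixed.output d c, fun e b ψ => by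
      cases b with
      | output o =>
        rw [Mixed.output_play, Party.andThen, ← mul_assoc, ← add_mul]
        exact hf o d a ψ⟩
  | m :: s, d, a => by
    have h0 : ∀ (e : ℕ) (b : Party other (m :: s) e) (M : Mixed me (m :: s) d)
        (ψ : Fin d → Fin e → ℂ), 0 ≤ α * weight ψ + β * M.play (win c) b ψ := fun e b M ψ =>
      add_nonneg (mul_nonneg hα (weight_nonneg _))
        (mul_nonneg hβ (Mixed.play_nonneg (win_nonneg c) _ _ _))
    cases a with
    | send hm ι mem K hK next =>
      choose M hM using fun k => exists_mixed_andThen hα hβ hf s (next k)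
      refine ⟨.ofParty (.sendMixed hm ι mem K hK M), fun e b ψ => ?_⟩
      cases b with
      | send hm' κ mem' K' hK' next' =>
        rw [Party.andThen]
        exact le_of_eq_of_le rfl (h0 _ _ _ _)
      | recv hm' κ mem' L hL next' =>
        -- Conservation of weight distributes the term `α * weight ψ` over the branches.
        rw [Mixed.ofParty_play, play_sendMixed, ← sum_weight_transmitAB K hK L hL, Party.andThen]
        simp only [Finset.mul_sum, ← Finset.sum_add_distrib]
        exact Finset.sum_le_sum fun k _ => Finset.sum_le_sum fun l _ => hM k _ _ _
    | recv hm ι mem L hL next =>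
      choose M hM using fun k => exists_mixed_andThen hα hβ hf s (next k)
      refine ⟨.ofParty (.recvMixed hm ι mem L hL M), fun e b ψ => ?_⟩
      cases b with
      | recv hm' κ mem' L' hL' next' =>
        rw [Party.andThen]
        exact le_of_eq_of_le rfl (h0 _ _ _ _)
      | send hm' κ mem' K hK next' =>
        rw [Mixed.ofParty_play, play_recvMixed, ← sum_weight_transmitBA L hL K hK, Party.andThen]
        simp only [Finset.mul_sum, ← Finset.sum_add_distrib]
        exact Finset.sum_le_sum fun k _ => Finset.sum_le_sum fun l _ => hM k _ _ _

/-! ### Absorbing the initial state -/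

theorem sum_gram_mul {α β : Type*} [Fintype α] [DecidableEq α] [Fintype β] [DecidableEq β]
    {ι : Type*} [Fintype ι] {γ : ι → Type*} [∀ k, Fintype (γ k)]
    (K : (k : ι) → Matrix (γ k) α ℂ) (hK : ∑ k, (K k)ᴴ * K k = 1) (V : Matrix α β ℂ)
    (hV : Vᴴ * V = 1) : ∑ k, (K k * V)ᴴ * (K k * V) = 1 := by
  have h : ∀ k, (K k * V)ᴴ * (K k * V) = Vᴴ * ((K k)ᴴ * K k) * V := fun k => by
    simp only [Matrix.conjTranspose_mul, Matrix.mul_assoc]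
  simp only [h]
  rw [← Matrix.sum_mul, ← Matrix.mul_sum, hK, Matrix.mul_one, hV]

theorem transmitAB_mul_col {d d' e' x : ℕ} (K : Matrix (Fin d' × Fin x) (Fin d) ℂ)
    (L : Matrix (Fin e') (Fin 1 × Fin x) ℂ) (V : Matrix (Fin d) (Fin 1) ℂ) :
    transmitAB (K * V) L (fun _ _ => 1) = transmitAB K L V := by
  funext i' j'
  simp only [transmitAB, Matrix.mul_apply, Fin.sum_univ_one, Finset.sum_mul, mul_one]
  rw [Finset.sum_comm]
  exact Finset.sum_congr rfl fun i _ => Finset.sum_congr rfl fun q _ => by ring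

theorem transmitBA_mul_col {d d' e' x : ℕ} (K : Matrix (Fin e' × Fin x) (Fin 1) ℂ)
    (L : Matrix (Fin d') (Fin d × Fin x) ℂ) (V : Matrix (Fin d) (Fin 1) ℂ) :
    transmitBA K (L * (V ⊗ₖ (1 : Matrix (Fin x) (Fin x) ℂ))) (fun _ _ => 1) =
      transmitBA K L V := by
  funext i' j'
  have h : ∀ q : Fin x, (L * (V ⊗ₖ (1 : Matrix (Fin x) (Fin x) ℂ))) i' (0, q) =
      ∑ i, L i' (i, q) * V i 0 := fun q => by
    simp [Matrix.mul_apply, Fintype.sum_prod_type, Matrix.one_apply]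
  simp only [transmitBA, Fin.sum_univ_one, h, Finset.mul_sum, mul_one]
  rw [Finset.sum_comm]
  exact Finset.sum_congr rfl fun i _ => Finset.sum_congr rfl fun q _ => by ring

/-- A unit vector is an isometry `V` from `ℂ^1` to `ℂ^d`, and preparing it can be absorbed into the
first Kraus operators. If no message is left then `d = 1`, and `v` is a mere phase. -/
theorem exists_play_eq_of_unit {me other : Role} {s : List Message} {d : ℕ} (a : Party me s d)
    (v : Fin d → ℂ) (hv : ∑ i, ‖v i‖ ^ 2 = 1) : ∃ a' : Party me s 1,
      ∀ (w : Outcome → Outcome → ℝ) (b : Party other s 1),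
        play w a b (fun i _ => v i) = play w a' b fun _ _ => 1 := by
  let V : Matrix (Fin d) (Fin 1) ℂ := Matrix.of fun i _ => v i
  have hV : Vᴴ * V = 1 := by
    ext i j
    have := sum_norm_sq_eq_dotProduct v
    rw [hv] at this
    fin_cases i; fin_cases j
    simpa [V, Matrix.mul_apply, dotProduct] using this.symm
  cases a with
  | output o =>
    refine ⟨.output o, fun w b => ?_⟩
    cases b
    simp only [Finset.univ_unique, Finset.sum_singleton] at hv
    simp only [play, Fin.default_eq_zero] at hv ⊢
    simp [hv]
  | @send m _ _ hm ι _ mem K hK next =>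
    refine ⟨.send hm ι mem (fun k => K k * V) (sum_gram_mul K hK V hV) next, fun w b => ?_⟩
    cases b with
    | send => rfl
    | recv hm' κ mem' L hL next' =>
      rw [play, play]
      refine Finset.sum_congr rfl fun k _ => Finset.sum_congr rfl fun l _ => congrArg _ ?_
      rw [transmitAB_mul_col]
      rfl
  | @recv m _ _ hm ι _ mem L hL next =>
    have hW : (V ⊗ₖ (1 : Matrix (Fin m.dim) (Fin m.dim) ℂ))ᴴ *
        (V ⊗ₖ (1 : Matrix (Fin m.dim) (Fin m.dim) ℂ)) = 1 := by
      rw [Matrix.conjTranspose_kronecker, ← Matrix.mul_kronecker_mul, hV]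
      simp
    refine ⟨.recv hm ι mem (fun k => L k * (V ⊗ₖ (1 : Matrix (Fin m.dim) (Fin m.dim) ℂ)))
      (sum_gram_mul L hL _ hW) next, fun w b => ?_⟩
    cases b with
    | recv => rfl
    | send hm' κ mem' K hK next' =>
      rw [play, play]
      refine Finset.sum_congr rfl fun k _ => Finset.sum_congr rfl fun l _ => congrArg _ ?_
      rw [transmitBA_mul_col]
      rfl

/-- As the opponent's memory is `ℂ^1`, the state is a vector on the cheater's side alone. If nonzero
it is normalised and absorbed into the cheater's program; `play_smul` restores the factor. -/
theorem play_le_mul_weight {w : Outcome → Outcome → ℝ} {me other : Role} {s : List Message}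
    {b : Party other s 1} {V : ℝ} (hb : ∀ a : Party me s 1, play w a b (fun _ _ => 1) ≤ V)
    {d : ℕ} (a : Party me s d) (ψ : Fin d → Fin 1 → ℂ) : play w a b ψ ≤ V * weight ψ := by
  have hw : weight ψ = ∑ i, ‖ψ i 0‖ ^ 2 := by simp [weight]
  rcases (weight_nonneg ψ).eq_or_lt with h | h
  · have hψ : ψ = fun _ _ => 0 := by
      funext i j
      rw [hw, eq_comm, Finset.sum_eq_zero_iff_of_nonneg fun _ _ => sq_nonneg _] at h
      simpa [Subsingleton.elim j 0] using h i
    rw [← h, hψ, play_zero, mul_zero]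
  · have hr : ((√(weight ψ) : ℝ) : ℂ) ≠ 0 := by
      simpa using (Real.sqrt_pos.mpr h).ne'
    have hn : ‖((√(weight ψ) : ℝ) : ℂ)‖ ^ 2 = weight ψ := by
      simp [Real.sq_sqrt h.le]
    obtain ⟨a', ha'⟩ := exists_play_eq_of_unit (other := other) a
      (fun i => ψ i 0 / (√(weight ψ) : ℝ)) (by
        simp only [norm_div, div_pow, hn]
        rw [← Finset.sum_div, ← hw, div_self h.ne'])
    have hψ : ψ = fun i _ => ((√(weight ψ) : ℝ) : ℂ) * (ψ i 0 / (√(weight ψ) : ℝ)) := by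
      funext i j
      rw [mul_div_cancel₀ _ hr, Subsingleton.elim j 0]
    calc play w a b ψ
        = play w a b fun i _ => ((√(weight ψ) : ℝ) : ℂ) * (ψ i 0 / (√(weight ψ) : ℝ)) :=
          congrArg _ hψ
      _ = weight ψ * play w a' b fun _ _ => 1 := by
          rw [play_smul w a b _ fun i _ => ψ i 0 / (√(weight ψ) : ℝ), hn, ha']
      _ ≤ V * weight ψ := by
          rw [mul_comm]
          exact mul_le_mul_of_nonneg_right (hb a') h.le

theorem Mixed.play_le_mul_weight {w : Outcome → Outcome → ℝ} {me other : Role}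
    {s : List Message} {b : Party other s 1} {V : ℝ}
    (hb : ∀ a : Party me s 1, CoinFlipping.play w a b (fun _ _ => 1) ≤ V) {d : ℕ}
    (M : Mixed me s d) (ψ : Fin d → Fin 1 → ℂ) : M.play w b ψ ≤ V * weight ψ := by
  rw [← sum_weight_act M.J M.complete, Finset.mul_sum]
  exact Finset.sum_le_sum fun k _ => CoinFlipping.play_le_mul_weight hb _ _

theorem play_extend_le {c : Outcome} (hc : c ≠ .abort) {me other : Role} {s t : List Message}
    (h : Fits s t) {b : Party other s 1} {V : ℝ}
    (hb : ∀ a : Party me s 1, play (win c) a b (fun _ _ => 1) ≤ V) {d : ℕ} (a : Party me t d)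
    (ψ : Fin d → Fin 1 → ℂ) : play (win c) a (b.extend t h) ψ ≤ V * weight ψ := by
  obtain ⟨M, hM⟩ := exists_mixed_extend hc (other := other) s t h a
  exact (hM _ b ψ).trans (M.play_le_mul_weight hb ψ)

theorem play_andThen_le {w : Outcome → Outcome → ℝ} {c : Outcome} {me other : Role}
    {s t : List Message} {b : Party other s 1} {f : Outcome → Party other t 1} {α β p : ℝ}
    (hα : 0 ≤ α) (hβ : 0 ≤ β)
    (hf : ∀ (o : Outcome) (d : ℕ) (a : Party me t d) (ψ : Fin d → Fin 1 → ℂ),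
      play w a (f o) ψ ≤ (α + β * win c c o) * weight ψ)
    (hb : ∀ a : Party me s 1, play (win c) a b (fun _ _ => 1) ≤ p) (a : Party me (s ++ t) 1) :
    play w a (b.andThen f) (fun _ _ => 1) ≤ α + β * p := by
  obtain ⟨M, hM⟩ := exists_mixed_andThen hα hβ hf s a
  refine (hM _ b _).trans ?_
  have := M.play_le_mul_weight hb fun _ _ => 1
  rw [weight_one] at this ⊢
  rw [mul_one] at this ⊢
  gcongr

/-! ### Honest players -/

/-- Idle players have their outputs fixed in advance, so `w` may be replaced by a constant and
`play_const` applies. -/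
theorem play_idle_congr {w w' : Outcome → Outcome → ℝ} {o o' : Outcome} (h : w o o' = w' o o')
    {me other : Role} : ∀ (t : List Message) (ψ : Fin 1 → Fin 1 → ℂ),
      play w (Party.idle o t : Party me t 1) (Party.idle o' t : Party other t 1) ψ =
        play w' (Party.idle o t : Party me t 1) (Party.idle o' t : Party other t 1) ψ
  | [], ψ => by simp [Party.idle, play, h]
  | m :: t, ψ => by
    simp only [Party.idle]
    split <;> split <;> simp only [play, play_idle_congr h t]

theorem play_idle_idle (w : Outcome → Outcome → ℝ) (o o' : Outcome) {me other : Role}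
    (hne : me ≠ other) (t : List Message) (ψ : Fin 1 → Fin 1 → ℂ) :
    play w (Party.idle o t : Party me t 1) (Party.idle o' t : Party other t 1) ψ =
      w o o' * weight ψ := by
  exact (play_idle_congr (w' := fun _ _ => w o o') rfl t ψ).trans (play_const _ hne _ _ _)

theorem transmitBA_embed {d e d' e' x y : ℕ} (h : x ≤ y)
    (K : Matrix (Fin e' × Fin x) (Fin e) ℂ) (L : Matrix (Fin d') (Fin d × Fin x) ℂ)
    (ψ : Fin d → Fin e → ℂ) :
    transmitBA (embedSend (y := y) K) (embedRecv L) ψ = transmitBA K L ψ := by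
  rw [transmitBA_swap, transmitAB_embed h, ← transmitBA_swap]

theorem play_send_recv (w : Outcome → Outcome → ℝ) {me other : Role} {m : Message}
    {s : List Message} {d e : ℕ} (hm : m.sender = me) (ι : Type) [Fintype ι] (mem : ι → ℕ)
    (K : (k : ι) → Matrix (Fin (mem k) × Fin m.dim) (Fin d) ℂ) (hK : ∑ k, (K k)ᴴ * K k = 1)
    (next : (k : ι) → Party me s (mem k)) (hm' : m.sender ≠ other) (κ : Type) [Fintype κ]
    (mem' : κ → ℕ) (L : (l : κ) → Matrix (Fin (mem' l)) (Fin e × Fin m.dim) ℂ)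
    (hL : ∑ l, (L l)ᴴ * L l = 1) (next' : (l : κ) → Party other s (mem' l))
    (ψ : Fin d → Fin e → ℂ) :
    play w (.send hm ι mem K hK next) (.recv hm' κ mem' L hL next') ψ =
      ∑ k, ∑ l, play w (next k) (next' l) (transmitAB (K k) (L l) ψ) := rfl

theorem play_recv_send (w : Outcome → Outcome → ℝ) {me other : Role} {m : Message}
    {s : List Message} {d e : ℕ} (hm : m.sender ≠ me) (ι : Type) [Fintype ι] (mem : ι → ℕ)
    (L : (k : ι) → Matrix (Fin (mem k)) (Fin d × Fin m.dim) ℂ) (hL : ∑ k, (L k)ᴴ * L k = 1)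
    (next : (k : ι) → Party me s (mem k)) (hm' : m.sender = other) (κ : Type) [Fintype κ]
    (mem' : κ → ℕ) (K : (l : κ) → Matrix (Fin (mem' l) × Fin m.dim) (Fin e) ℂ)
    (hK : ∑ l, (K l)ᴴ * K l = 1) (next' : (l : κ) → Party other s (mem' l))
    (ψ : Fin d → Fin e → ℂ) :
    play w (.recv hm ι mem L hL next) (.send hm' κ mem' K hK next') ψ =
      ∑ k, ∑ l, play w (next k) (next' l) (transmitBA (K l) (L k) ψ) := rfl

/-- Honest messages stay in the embedded subspace, so every rejecting branch carries the zero
vector. -/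
theorem play_extend_extend (w : Outcome → Outcome → ℝ) {me other : Role} (hne : me ≠ other)
    {s : List Message} {d e : ℕ} (a : Party me s d) (b : Party other s e) (t : List Message)
    (h : Fits s t) (ψ : Fin d → Fin e → ℂ) :
    play w (a.extend t h) (b.extend t h) ψ = play w a b ψ := by
  induction a generalizing e t with
  | output o =>
    cases b
    simp [Party.extend, play_idle_idle w _ _ hne, play, weight]
  | @send m s d hm ι _ mem K hK next ih =>
    cases b with
    | send hm' => exact absurd (hm.symm.trans hm') hne
    | recv hm' κ mem' L hL next' =>
      cases t with
      | nil => exact h.elim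
      | cons m' t =>
        have key : ∀ k, ∑ p : Fin e × Fin m'.dim, play w ((next k).extend t h.2.2)
            (Party.idle .abort t : Party other t 1)
            (transmitAB (embedSend (y := m'.dim) (K k)) (rejectRecv (x := m.dim) p) ψ) = 0 :=
          fun k => Finset.sum_eq_zero fun p _ => by rw [transmitAB_rejectRecv, play_zero]
        calc play w ((Party.send hm ι mem K hK next).extend (m' :: t) h)
              ((Party.recv hm' κ mem' L hL next').extend (m' :: t) h) ψ
            = ∑ k, (∑ l, play w ((next k).extend t h.2.2) ((next' l).extend t h.2.2)
                (transmitAB (embedSend (y := m'.dim) (K k)) (embedRecv (L l)) ψ) +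
              ∑ p : Fin e × Fin m'.dim, play w ((next k).extend t h.2.2)
                (Party.idle .abort t : Party other t 1)
                (transmitAB (embedSend (y := m'.dim) (K k)) (rejectRecv (x := m.dim) p) ψ)) := by
              rw [Party.extend, Party.extend]
              refine (play_send_recv ..).trans (Finset.sum_congr rfl fun k _ => ?_)
              rw [Fintype.sum_sum_type]
              rfl
          _ = _ := by
              simp only [key, add_zero, play]
              refine Finset.sum_congr rfl fun k _ => Finset.sum_congr rfl fun l _ => ?_
              exact (congrArg _ (transmitAB_embed h.2.1 _ _ _)).trans (ih k _ t h.2.2 _)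
  | @recv m s d hm ι _ mem L hL next ih =>
    cases b with
    | recv hm' =>
      refine absurd ?_ hne
      cases h : m.sender <;> cases me <;> cases other <;> simp_all
    | send hm' κ mem' K hK next' =>
      cases t with
      | nil => exact h.elim
      | cons m' t =>
        have key : ∑ p : Fin d × Fin m'.dim, ∑ l, play w (Party.idle .abort t : Party me t 1)
            ((next' l).extend t h.2.2)
            (transmitBA (embedSend (y := m'.dim) (K l)) (rejectRecv (x := m.dim) p) ψ) = 0 :=
          Finset.sum_eq_zero fun p _ => Finset.sum_eq_zero fun l _ => by
            rw [transmitBA_swap, transmitAB_rejectRecv, play_zero]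
        calc play w ((Party.recv hm ι mem L hL next).extend (m' :: t) h)
              ((Party.send hm' κ mem' K hK next').extend (m' :: t) h) ψ
            = (∑ k, ∑ l, play w ((next k).extend t h.2.2) ((next' l).extend t h.2.2)
                (transmitBA (embedSend (y := m'.dim) (K l)) (embedRecv (L k)) ψ)) +
              ∑ p : Fin d × Fin m'.dim, ∑ l, play w (Party.idle .abort t : Party me t 1)
                ((next' l).extend t h.2.2)
                (transmitBA (embedSend (y := m'.dim) (K l)) (rejectRecv (x := m.dim) p) ψ) := by
              rw [Party.extend, Party.extend]
              refine (play_recv_send ..).trans ?_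
              rw [Fintype.sum_sum_type]
              rfl
          _ = _ := by
              rw [key, add_zero, play]
              refine Finset.sum_congr rfl fun k _ => Finset.sum_congr rfl fun l _ => ?_
              exact (congrArg _ (transmitBA_embed h.2.1 _ _ _)).trans (ih k _ t h.2.2 _)

/-- Between the phases both memories are `ℂ^1`, so the state is a scalar and the value of the second
phase acts as a payoff for the first. -/
theorem play_andThen_andThen (w : Outcome → Outcome → ℝ) {me other : Role}
    {s t : List Message} {d e : ℕ} (a : Party me s d) (b : Party other s e)
    (f : Outcome → Party me t 1) (g : Outcome → Party other t 1) (ψ : Fin d → Fin e → ℂ) :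
    play w (a.andThen f) (b.andThen g) ψ =
      play (fun x y => play w (f x) (g y) fun _ _ => 1) a b ψ := by
  induction a generalizing e with
  | output o =>
    cases b with
    | output o' =>
      have hψ : ψ = fun i j => ψ 0 0 * (fun _ _ => 1 : Fin 1 → Fin 1 → ℂ) i j := by
        funext i j
        rw [Subsingleton.elim i 0, Subsingleton.elim j 0, mul_one]
      rw [Party.andThen, Party.andThen, play, mul_comm, ← play_smul, ← hψ]
  | send hm ι mem K hK next ih => cases b <;> simp [Party.andThen, play, ih]
  | recv hm ι mem K hK next ih => cases b <;> simp [Party.andThen, play, ih]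

theorem win_sum (x y : Outcome) : win .zero x y + win .one x y + win .abort x y = 1 := by
  cases x <;> cases y <;> simp [win, Outcome.joint]

/-- If the honest players never abort, only the payoffs at agreeing outputs matter. -/
theorem play_eq_of_no_abort {s : List Message} (a : Party .alice s 1) (b : Party .bob s 1)
    (h : prob a b .zero + prob a b .one = 1) {u : Outcome → Outcome → ℝ} {r : ℝ}
    (hu0 : ∀ x y, 0 ≤ u x y) (hu : ∀ x y, u x y ≤ r) :
    play u a b (fun _ _ => 1) =
      u .zero .zero * prob a b .zero + u .one .one * prob a b .one := by
  simp only [prob_eq_play] at h ⊢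
  have hr : 0 ≤ r := (hu0 .zero .zero).trans (hu _ _)
  have habort : play (win .abort) a b (fun _ _ => 1) = 0 := by
    have h1 : play (fun x y => win .zero x y + win .one x y + win .abort x y) a b
        (fun _ _ => 1) = 1 := by
      simp only [win_sum]
      rw [play_const 1 (by simp), weight_one, one_mul]
    rw [play_add, play_add] at h1
    linarith
  -- All pairs other than (`zero`, `zero`) and (`one`, `one`) have joint outcome `abort`.
  have hdec : u = fun x y => u .zero .zero * win .zero x y + u .one .one * win .one x y +
      u x y * win .abort x y := by
    funext x y
    cases x <;> cases y <;> simp [win, Outcome.joint]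
  have hrest : play (fun x y => u x y * win .abort x y) a b (fun _ _ => 1) = 0 := by
    refine le_antisymm ?_
      (play_nonneg (fun x y => mul_nonneg (hu0 x y) (win_nonneg _ _ _)) _ _ _)
    -- Two nonnegative payoffs add up to `r` times the abort probability, which is 0, so both
    -- vanish.
    have hsplit : play (fun x y => r * win .abort x y) a b (fun _ _ => 1) =
        play (fun x y => u x y * win .abort x y) a b (fun _ _ => 1) +
          play (fun x y => (r - u x y) * win .abort x y) a b (fun _ _ => 1) := by
      rw [← play_add]
      congr 1
      funext x y
      ring
    rw [play_const_mul, habort, mul_zero] at hsplit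
    have := play_nonneg (w := fun x y => (r - u x y) * win .abort x y)
      (fun x y => mul_nonneg (sub_nonneg.mpr (hu x y)) (win_nonneg _ _ _)) a b fun _ _ => 1
    linarith
  rw [hdec, play_add, play_add, play_const_mul, play_const_mul, hrest, add_zero]
  simp [win, Outcome.joint]

theorem prob_nonneg {s : List Message} (a : Party .alice s 1) (b : Party .bob s 1)
    (c : Outcome) : 0 ≤ prob a b c := by
  rw [prob_eq_play]
  exact play_nonneg (win_nonneg c) _ _ _

theorem prob_le_one {s : List Message} (a : Party .alice s 1) (b : Party .bob s 1)
    (c : Outcome) : prob a b c ≤ 1 := by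
  have h : play (fun x y => win .zero x y + win .one x y + win .abort x y) a b
      (fun _ _ => 1) = 1 := by
    simp only [win_sum]
    rw [play_const 1 (by simp), weight_one, one_mul]
  rw [play_add, play_add, ← prob_eq_play, ← prob_eq_play, ← prob_eq_play] at h
  have h0 := prob_nonneg a b .zero
  have h1 := prob_nonneg a b .one
  have h2 := prob_nonneg a b .abort
  cases c <;> linarith

theorem prob_andThen {s t : List Message} {a : Party .alice s 1} {b : Party .bob s 1}
    (h : prob a b .zero + prob a b .one = 1) (f : Outcome → Party .alice t 1)
    (g : Outcome → Party .bob t 1) (c : Outcome) :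
    prob (a.andThen f) (b.andThen g) c =
      prob (f .zero) (g .zero) c * prob a b .zero + prob (f .one) (g .one) c * prob a b .one := by
  rw [prob_eq_play, play_andThen_andThen]
  simp only [← prob_eq_play]
  exact play_eq_of_no_abort a b h (fun _ _ => prob_nonneg _ _ _) fun _ _ => prob_le_one _ _ _

theorem prob_extend {s t : List Message} (h : Fits s t) (a : Party .alice s 1)
    (b : Party .bob s 1) (c : Outcome) :
    prob (a.extend t h) (b.extend t h) c = prob a b c := by
  rw [prob_eq_play, play_extend_extend _ (by simp), prob_eq_play]

theorem play_idle_abort_le {c : Outcome} (hc : c ≠ .abort) {me other : Role} {t : List Message}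
    {r : ℝ} (hr : 0 ≤ r) {d : ℕ} (a : Party me t d) (ψ : Fin d → Fin 1 → ℂ) :
    play (win c) a (Party.idle .abort t : Party other t 1) ψ ≤ r * weight ψ :=
  play_idle_le hr (fun o => (win_abort hc o).trans_le hr) a ψ

end CoinFlipping

open CoinFlipping in
theorem mainTheorem5 {n m₁ m₂ : ℕ} (P : CoinFlipping.Protocol n)
    (P₁ : CoinFlipping.Protocol m₁) (P₂ : CoinFlipping.Protocol m₂)
    (ε ε₀ z₁ z₂ : ℝ) (hz : z₁ ≤ z₂)
    (hP : P.IsWCF (1 / 2) ε) (hP₁ : P₁.IsWCF z₁ ε₀) (hP₂ : P₂.IsWCF z₂ ε₀) :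
    (CoinFlipping.comb P P₁ P₂).IsWCF ((z₁ + z₂) / 2) (ε₀ + ε * (z₂ - z₁)) := by
  have hone : prob P.alice P.bob .zero + prob P.alice P.bob .one = 1 := by
    rw [hP.honest_alice_wins, hP.honest_bob_wins]
    norm_num
  refine ⟨?_, ?_, fun a => ?_, fun b => ?_⟩
  · refine (prob_andThen hone _ _ _).trans ?_
    simp only [prob_extend]
    rw [hP.honest_alice_wins, hP.honest_bob_wins, hP₁.honest_alice_wins, hP₂.honest_alice_wins]
    ring
  · refine (prob_andThen hone _ _ _).trans ?_
    simp only [prob_extend]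
    rw [hP.honest_alice_wins, hP.honest_bob_wins, hP₁.honest_bob_wins, hP₂.honest_bob_wins]
    ring
  -- This bounds a probability, so it is nonnegative; the abort branch needs that. The final value
  -- is `α + β * p` with `α = z₁ + ε₀`, `β = z₂ - z₁`, `p = 1/2 + ε`.
  · have hα : 0 ≤ z₁ + ε₀ := (prob_nonneg _ _ _).trans (hP₁.cheating_alice P₁.alice)
    have hβ : 0 ≤ z₂ - z₁ := sub_nonneg.mpr hz
    rw [prob_eq_play]
    refine (play_andThen_le (c := .zero) hα hβ ?_
      (fun a => (prob_eq_play a P.bob .zero).symm.trans_le (hP.cheating_alice a)) a).trans_eq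
      (by ring)
    rintro (_ | _ | _) d a ψ
    · refine (play_extend_le (by simp) _ (fun a =>
        (prob_eq_play a P₂.bob .zero).symm.trans_le (hP₂.cheating_alice a)) a ψ).trans_eq ?_
      simp only [win, Outcome.joint, if_true]
      ring
    · refine (play_extend_le (by simp) _ (fun a =>
        (prob_eq_play a P₁.bob .zero).symm.trans_le (hP₁.cheating_alice a)) a ψ).trans_eq ?_
      simp [win, Outcome.joint]
    · exact play_idle_abort_le (by simp) (add_nonneg hα (mul_nonneg hβ (win_nonneg _ _ _))) a ψ
  -- For Bob the worse branch is `P₂`, with bound `1 - z₂ + ε₀`; winning `P` leads to `P₁` and again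
  -- adds `z₂ - z₁`.
  · have hα : 0 ≤ 1 - z₂ + ε₀ := (prob_nonneg _ _ _).trans (hP₂.cheating_bob P₂.bob)
    have hβ : 0 ≤ z₂ - z₁ := sub_nonneg.mpr hz
    rw [prob_eq_play_swap]
    refine (play_andThen_le (c := .one) hα hβ ?_
      (fun b => (prob_eq_play_swap P.alice b .one).symm.trans_le (hP.cheating_bob b)) b).trans_eq
      (by ring)
    rintro (_ | _ | _) d b ψ
    · refine (play_extend_le (by simp) _ (fun b =>
        (prob_eq_play_swap P₂.alice b .one).symm.trans_le (hP₂.cheating_bob b)) b ψ).trans_eq ?_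
      simp [win, Outcome.joint]
    · refine (play_extend_le (by simp) _ (fun b =>
        (prob_eq_play_swap P₁.alice b .one).symm.trans_le (hP₁.cheating_bob b)) b ψ).trans_eq ?_
      simp only [win, Outcome.joint, if_true]
      ring
    · exact play_idle_abort_le (by simp) (add_nonneg hα (mul_nonneg hβ (win_nonneg _ _ _))) b ψ
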